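/- Let $k$ be an algebraically closed field, let $n, d$ be positive integers with $d \le n$, let $M \cong \mathbb{Z}^n$ be a lattice, $N = \mathrm{Hom}(M,\mathbb{Z})$, $N_{\mathbb{R}} = N \otimes \mathbb{R}$, and let $T = \mathrm{Spec}(k[M])$ be the torus with characters $\chi^u$, $u \in M$. A cone in $N$ is a pointed rational polyhedral cone in $N_{\mathbb{R}}$, a fan in $N$ is a finite nonempty fan of such cones, and a fan is unimodular if each of its cones is generated by part of a $\mathbb{Z}$-basis of $N$. For a fan $\Delta$ in $N$, let $Y(\Delta)$ be its toric variety. For $w \in N_{\mathbb{R}}$ and $f = \sum_v a_v \chi^v \in k[M]$, let $\mathrm{in}_w f$ be the sum of those terms $a_v\chi^v$, $a_v \neq 0$, for which $\langle v, w\rangle$ is minimal, and let $\mathrm{supp}$ denote the set of exponents occurring with nonzero coefficient; for a closed subscheme $X \subset T$ with ideal $I$, let $\mathrm{in}_w X \subset T$ be defined by the ideal generated by all $\mathrm{in}_w f$, $f \in I$. A fan $\Delta$ is a tropical fan for a reduced closed subscheme $X \subset T$ of pure dimension $d$ if the closure $X^\Delta$ of $X$ in $Y(\Delta)$ is complete and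 the multiplication map $T \times_k X^\Delta \to Y(\Delta)$ is faithfully flat. Let $f_1, \dots, f_{n-d} \in k[M]$, let $\Delta, \overline{\Delta}$ be fans in $N$, let $\sigma \in \overline{\Delta}$, and let $X \subset T$ be the closed subscheme defined by the ideal $(f_1, \dots, f_{n-d})$. Suppose that (i) $X$ is reduced and of pure dimension $d$; (ii) $\Delta \subset \overline{\Delta}$; (iii) $\overline{\Delta}$ is unimodular; (iv) $\Delta$ is a tropical fan for $X \subset T$; (v) for each face $\tau$ of $\sigma$, all $w_1, w_2 \in \mathrm{relint}(\tau)$ and each $i$, $\mathrm{in}_{w_1} f_i = \mathrm{in}_{w_2} f_i$; (vi) for each $w \in \sigma$, $\mathrm{in}_w f_1, \dots, \mathrm{in}_w f_{n-d}$ generate the ideal of $\mathrm{in}_w X$ in $k[M]$. Let $Y(\sigma) = \mathrm{Spec}(k[\sigma^\vee \cap M])$ and let $X^\sigma \subset Y(\sigma)$ be the closure of $X$. Then for each $i$ and each $v \in M$, one has $v \in \mathrm{supp}(\mathrm{in}_w f_i)$ for all $w \in \mathrm{relint}(\sigma)$ if and only if this holds for some $w \in \mathrm{relint}(\sigma)$.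 Moreover, if $u_1, \dots, u_{n-d} \in M$ are such that for each $i$, $-u_i \in \mathrm{supp}(\mathrm{in}_w f_i)$ for all (equivalently, some) $w \in \mathrm{relint}(\sigma)$, then $\chi^{u_1} f_1, \dots, \chi^{u_{n-d}} f_{n-d}$ lie in $k[\sigma^\vee \cap M]$ and generate the ideal of $X^\sigma$ in $k[\sigma^\vee \cap M]$. -/

import Mathlib

universe u

noncomputable section

namespace Toric

open AlgebraicGeometry CategoryTheory Limits TensorProduct

/-- The real vector space `N_ℝ = N ⊗ ℝ`, for `N = Hom(M, ℤ)`, in its canonical form `Hom(M, ℝ)`; the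
pairing of `u : M` with `w : N_ℝ` is `w u`. -/
abbrev NReal (M : Type u) [AddCommGroup M] : Type u := M →ₗ[ℤ] ℝ

variable {M : Type u} [AddCommGroup M]

/-- For a lattice `M`, the topology of pointwise convergence is the Euclidean topology of the
finite-dimensional space `N_ℝ`. -/
instance : TopologicalSpace (NReal M) :=
  TopologicalSpace.induced (fun (w : NReal M) (u : M) => w u) inferInstance

/-- The embedding `N = Hom(M, ℤ) → N_ℝ`. -/
def latticeVector (v : M →ₗ[ℤ] ℤ) : NReal M :=
  (Int.castAddHom ℝ).toIntLinearMap ∘ₗ v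

/-- The relative interior of a cone. -/
def relint (σ : PointedCone ℝ (NReal M)) : Set (NReal M) :=
  intrinsicInterior ℝ (σ : Set (NReal M))

/-- The monoid `σ^∨ ∩ M`. -/
def dualMonoid (σ : PointedCone ℝ (NReal M)) : AddSubmonoid M where
  carrier := {u | ∀ w ∈ σ, 0 ≤ w u}
  zero_mem' w _ := by simp
  add_mem' hu hv w hw := by simpa using add_nonneg (hu w hw) (hv w hw)

/-- A cone in `N`: a rational polyhedral cone (generated by finitely many elements of `N`) that is
pointed, i.e. contains no line. -/
structure IsCone (σ : PointedCone ℝ (NReal M)) : Prop where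
  rational : ∃ s : Finset (M →ₗ[ℤ] ℤ), σ = PointedCone.hull ℝ (latticeVector '' (s : Set (M →ₗ[ℤ] ℤ)))
  pointed : (σ : ConvexCone ℝ (NReal M)).Salient

/-- `τ` is a face of `σ`: `τ = σ ∩ m^⊥` for some `m ∈ σ^∨ ∩ M`. (For a rational polyhedral cone each
supporting hyperplane section is cut out by an integral `m`.) -/
def IsFace (τ σ : PointedCone ℝ (NReal M)) : Prop :=
  ∃ m ∈ dualMonoid σ, ∀ w, w ∈ τ ↔ w ∈ σ ∧ w m = 0

theorem dualMonoid_anti {τ σ : PointedCone ℝ (NReal M)} (h : τ ≤ σ) :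
    dualMonoid σ ≤ dualMonoid τ := fun _ hu w hw => hu w (h hw)

variable (k : Type u) [Field k]

/-- The ring `k[σ^∨ ∩ M]`. -/
abbrev CoordRing (σ : PointedCone ℝ (NReal M)) : Type u := AddMonoidAlgebra k (dualMonoid σ)

/-- The inclusion `k[σ^∨ ∩ M] → k[M]`. -/
def incl (σ : PointedCone ℝ (NReal M)) : CoordRing k σ →ₐ[k] AddMonoidAlgebra k M :=
  AddMonoidAlgebra.mapDomainAlgHom k k (dualMonoid σ).subtype

/-- The inclusion `k[σ^∨ ∩ M] → k[τ^∨ ∩ M]` for `τ ⊆ σ`. -/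
def restrict {τ σ : PointedCone ℝ (NReal M)} (h : τ ≤ σ) : CoordRing k σ →ₐ[k] CoordRing k τ :=
  AddMonoidAlgebra.mapDomainAlgHom k k (AddSubmonoid.inclusion (dualMonoid_anti h))

theorem restrict_injective {τ σ : PointedCone ℝ (NReal M)} (h : τ ≤ σ) :
    Function.Injective (restrict k h) :=
  AddMonoidAlgebra.mapDomain_injective (AddSubmonoid.inclusion_injective _)

theorem exists_add_nsmul_mem {τ σ : PointedCone ℝ (NReal M)} (hσ : IsCone σ) {m : M}
    (hm : m ∈ dualMonoid σ) (hτ : ∀ w, w ∈ τ ↔ w ∈ σ ∧ w m = 0) {u : M}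
    (hu : u ∈ dualMonoid τ) : ∃ c : ℕ, ∀ c' ≥ c, u + c' • m ∈ dualMonoid σ := by
  classical
  obtain ⟨s, rfl⟩ := hσ.rational
  have key : ∀ v ∈ s, ∃ c : ℕ, ∀ c' ≥ c, 0 ≤ latticeVector v (u + c' • m) := by
    intro v hv
    have hvσ : latticeVector v ∈ PointedCone.hull ℝ (latticeVector '' (s : Set (M →ₗ[ℤ] ℤ))) :=
      Submodule.subset_span ⟨v, hv, rfl⟩
    have h0 := hm _ hvσ
    rcases h0.eq_or_lt with h | h
    · refine ⟨0, fun c' _ => ?_⟩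
      have := hu _ ((hτ _).2 ⟨hvσ, h.symm⟩)
      simpa [← h] using this
    · obtain ⟨c, hc⟩ := exists_nat_gt (-(latticeVector v u) / latticeVector v m)
      refine ⟨c, fun c' hc' => ?_⟩
      rw [div_lt_iff₀ h] at hc
      have : (c : ℝ) ≤ c' := by exact_mod_cast hc'
      simp only [map_add, map_nsmul, nsmul_eq_mul]
      nlinarith
  choose! c hc using key
  refine ⟨s.sup c, fun c' hc' => ?_⟩
  intro w hw
  induction hw using Submodule.span_induction with
  | mem x hx =>
    obtain ⟨v, hv, rfl⟩ := hx
    exact hc v hv c' (le_trans (Finset.le_sup hv) hc')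
  | zero => simp
  | add x y _ _ hx hy => simpa using add_nonneg hx hy
  | smul a x _ hx =>
    have := mul_nonneg a.2 hx
    exact this

theorem isLocalization_restrict {τ σ : PointedCone ℝ (NReal M)} (hσ : IsCone σ) (h : τ ≤ σ)
    {m : M} (hm : m ∈ dualMonoid σ) (hτ : ∀ w, w ∈ τ ↔ w ∈ σ ∧ w m = 0) :
    letI := (restrict k h).toRingHom.toAlgebra
    IsLocalization.Away (AddMonoidAlgebra.single (⟨m, hm⟩ : dualMonoid σ) (1 : k))
      (CoordRing k τ) := by
  let := (restrict k h).toRingHom.toAlgebra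
  have halg : ∀ x, algebraMap (CoordRing k σ) (CoordRing k τ) x = restrict k h x := fun _ => rfl
  have hsing : ∀ (a : dualMonoid σ) (r : k), restrict k h (AddMonoidAlgebra.single a r) =
      AddMonoidAlgebra.single (AddSubmonoid.inclusion (dualMonoid_anti h) a) r := by
    intro a r
    exact AddMonoidAlgebra.mapDomain_single
  refine IsLocalization.Away.mk _ ?_ ?_ ?_
  · have hneg : -m ∈ dualMonoid τ := fun w hw => by simp [((hτ w).1 hw).2]
    refine IsUnit.of_mul_eq_one (AddMonoidAlgebra.single ⟨-m, hneg⟩ 1) ?_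
    rw [halg, hsing, AddMonoidAlgebra.single_mul_single, AddMonoidAlgebra.one_def]
    congr 1
    · ext; simp
    · simp
  · intro g
    suffices H : ∃ c : ℕ, ∀ c' ≥ c, ∃ a, (restrict k h (AddMonoidAlgebra.single (⟨m, hm⟩ : dualMonoid σ) (1 : k))) ^ c' * g = restrict k h a by
      obtain ⟨c, hc⟩ := H
      obtain ⟨a, ha⟩ := hc c le_rfl
      exact ⟨c, a, by rw [halg, halg, mul_comm, ha]⟩
    induction g using AddMonoidAlgebra.induction_linear with
    | zero => exact ⟨0, fun _ _ => ⟨0, by simp⟩⟩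
    | add f g hf hg =>
      obtain ⟨c, hc⟩ := hf
      obtain ⟨d, hd⟩ := hg
      refine ⟨max c d, fun c' h' => ?_⟩
      obtain ⟨a, ha⟩ := hc c' (le_trans (le_max_left _ _) h')
      obtain ⟨b, hb⟩ := hd c' (le_trans (le_max_right _ _) h')
      exact ⟨a + b, by rw [mul_add, ha, hb, map_add]⟩
    | single v r =>
      obtain ⟨c, hc⟩ := exists_add_nsmul_mem hσ hm hτ v.2
      refine ⟨c, fun c' h' => ⟨AddMonoidAlgebra.single ⟨_, hc c' h'⟩ r, ?_⟩⟩
      rw [hsing, hsing, AddMonoidAlgebra.single_pow, AddMonoidAlgebra.single_mul_single]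
      congr 1
      · ext; simp [add_comm]
      · simp
  · intro a b hab
    exact ⟨0, by rw [restrict_injective k h hab]⟩


variable (M) in
/-- A fan in `N`: a finite nonempty collection of cones in `N`, closed under taking faces, any two of
which meet in a face of each. (Nonempty is stated as `{0} ∈ Δ`, as `{0}` is a face of each cone.) -/
structure Fan where
  cones : Set (PointedCone ℝ (NReal M))
  finite : cones.Finite
  bot_mem : ⊥ ∈ cones
  isCone : ∀ σ ∈ cones, IsCone σ
  face_mem : ∀ σ ∈ cones, ∀ τ, IsFace τ σ → τ ∈ cones
  inf_isFace : ∀ σ ∈ cones, ∀ τ ∈ cones, IsFace (σ ⊓ τ) σ ∧ IsFace (σ ⊓ τ) τ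

/-- A unimodular cone: one generated by part of a `ℤ`-basis of `N`. -/
def IsUnimodular (σ : PointedCone ℝ (NReal M)) : Prop :=
  ∃ (b : Module.Basis (Fin (Module.finrank ℤ M)) ℤ (M →ₗ[ℤ] ℤ)) (s : Set (Fin (Module.finrank ℤ M))),
    σ = PointedCone.hull ℝ ((fun i => latticeVector (b i)) '' s)

namespace Fan

theorem isFace_of_le (Δ : Fan M) {τ σ : PointedCone ℝ (NReal M)} (hτ : τ ∈ Δ.cones)
    (hσ : σ ∈ Δ.cones) (h : τ ≤ σ) : IsFace τ σ := by
  have := (Δ.inf_isFace σ hσ τ hτ).1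
  rwa [inf_eq_right.2 h] at this

variable (Δ : Fan M)

/-- The affine toric variety `Y(σ) = Spec k[σ^∨ ∩ M]`. -/
abbrev chart (σ : PointedCone ℝ (NReal M)) : Scheme.{u} := Spec (.of (CoordRing k σ))

/-- The morphism `Y(τ) → Y(σ)` for `τ ⊆ σ`. -/
def chartMap {τ σ : PointedCone ℝ (NReal M)} (h : τ ≤ σ) : chart k τ ⟶ chart k σ :=
  Spec.map (CommRingCat.ofHom (restrict k h).toRingHom)

/-- The diagram of the `Y(σ)`, `σ ∈ Δ`, with the open immersions `Y(τ) → Y(σ)` for `τ ⊆ σ`. -/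
def diagram : Δ.cones ⥤ Scheme.{u} where
  obj σ := chart k σ.1
  map f := chartMap k (leOfHom f)
  map_id σ := by
    rw [chartMap, ← Spec.map_id]
    congr 1
    ext : 1
    exact congrArg AlgHom.toRingHom (AddMonoidAlgebra.mapDomainAlgHom_id (R := k) (A := k))
  map_comp f g := by
    rw [chartMap, chartMap, chartMap, ← Spec.map_comp]
    congr 1
    ext : 1
    exact congrArg AlgHom.toRingHom (AddMonoidAlgebra.mapDomainAlgHom_comp (R := k) (A := k)
      (AddSubmonoid.inclusion (dualMonoid_anti (leOfHom g)))
      (AddSubmonoid.inclusion (dualMonoid_anti (leOfHom f))))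

instance instIsOpenImmersionMap {σ τ : Δ.cones} (f : σ ⟶ τ) : IsOpenImmersion ((Δ.diagram k).map f) := by
  obtain ⟨m, hm, h⟩ := Δ.isFace_of_le σ.2 τ.2 (leOfHom f)
  let := (restrict k (leOfHom f)).toRingHom.toAlgebra
  have := isLocalization_restrict k (Δ.isCone _ τ.2) (leOfHom f) hm h
  exact IsOpenImmersion.of_isLocalization
    (AddMonoidAlgebra.single (⟨m, hm⟩ : dualMonoid τ.1) (1 : k))

theorem range_diagram_map {σ τ : Δ.cones} (f : σ ⟶ τ) {m : M} (hm : m ∈ dualMonoid τ.1)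
    (h : ∀ w, w ∈ σ.1 ↔ w ∈ τ.1 ∧ w m = 0) :
    Set.range ((Δ.diagram k).map f) = (PrimeSpectrum.basicOpen
      (AddMonoidAlgebra.single (⟨m, hm⟩ : dualMonoid τ.1) (1 : k)) :
        Set (PrimeSpectrum (CoordRing k τ.1))) := by
  let := (restrict k (leOfHom f)).toRingHom.toAlgebra
  have := isLocalization_restrict k (Δ.isCone _ τ.2) (leOfHom f) hm h
  exact PrimeSpectrum.localization_away_comap_range (CoordRing k σ.1)
    (AddMonoidAlgebra.single (⟨m, hm⟩ : dualMonoid τ.1) (1 : k))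

instance : (Δ.diagram k ⋙ Scheme.forget).IsLocallyDirected where
  cond {i j l} fi fj xi xj hx := by
    obtain ⟨m, hm, h⟩ := Δ.isFace_of_le i.2 l.2 (leOfHom fi)
    obtain ⟨m', hm', h'⟩ := Δ.isFace_of_le j.2 l.2 (leOfHom fj)
    let e : Δ.cones := ⟨i.1 ⊓ j.1, Δ.face_mem _ i.2 _ (Δ.inf_isFace _ i.2 _ j.2).1⟩
    let gi : e ⟶ i := homOfLE (show i.1 ⊓ j.1 ≤ i.1 from inf_le_left)
    let gj : e ⟶ j := homOfLE (show i.1 ⊓ j.1 ≤ j.1 from inf_le_right)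
    have he : ∀ w, w ∈ e.1 ↔ w ∈ l.1 ∧ w (m + m') = 0 := by
      intro w
      rw [map_add]
      constructor
      · intro hw
        have h1 := (h w).1 hw.1
        have h2 := (h' w).1 hw.2
        exact ⟨h1.1, by rw [h1.2, h2.2, add_zero]⟩
      · rintro ⟨hw, h0⟩
        have h1 := hm w hw
        have h2 := hm' w hw
        exact ⟨(h w).2 ⟨hw, by linarith⟩, (h' w).2 ⟨hw, by linarith⟩⟩
    have hx' : (Δ.diagram k).map fi xi = (Δ.diagram k).map fj xj := hx
    have hr := Δ.range_diagram_map k (gi ≫ fi) (add_mem hm hm') he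
    have hmem : (Δ.diagram k).map fi xi ∈ Set.range ((Δ.diagram k).map (gi ≫ fi)) := by
      rw [hr]
      have h1 : (Δ.diagram k).map fi xi ∈ Set.range ((Δ.diagram k).map fi) := ⟨_, rfl⟩
      have h2 : (Δ.diagram k).map fi xi ∈ Set.range ((Δ.diagram k).map fj) := ⟨_, hx'.symm⟩
      rw [Δ.range_diagram_map k fi hm h] at h1
      rw [Δ.range_diagram_map k fj hm' h'] at h2
      have hs : (AddMonoidAlgebra.single (⟨m + m', add_mem hm hm'⟩ : dualMonoid l.1) (1 : k)) =
          AddMonoidAlgebra.single (⟨m, hm⟩ : dualMonoid l.1) (1 : k) *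
          AddMonoidAlgebra.single (⟨m', hm'⟩ : dualMonoid l.1) (1 : k) := by
        rw [AddMonoidAlgebra.single_mul_single, mul_one]
        rfl
      rw [hs, PrimeSpectrum.basicOpen_mul]
      exact ⟨h1, h2⟩
    obtain ⟨x, hx1⟩ := hmem
    refine ⟨e, gi, gj, x, ?_, ?_⟩
    · apply ((Δ.diagram k).map fi).isOpenEmbedding.injective
      refine Eq.trans ?_ hx1
      rw [Functor.map_comp]
      rfl
    · apply ((Δ.diagram k).map fj).isOpenEmbedding.injective
      rw [← hx', ← hx1, Subsingleton.elim (gi ≫ fi) (gj ≫ fj), Functor.map_comp]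
      rfl

/-- The toric variety `Y(Δ)`: the `Y(σ)`, `σ ∈ Δ`, glued along their common faces. -/
def toricVariety : Scheme.{u} := colimit (Δ.diagram k)

/-- The open immersion `Y(σ) → Y(Δ)`. -/
def chartι (σ : Δ.cones) : chart k σ.1 ⟶ Δ.toricVariety k := colimit.ι (Δ.diagram k) σ

instance (σ : Δ.cones) : IsOpenImmersion (Δ.chartι k σ) :=
  inferInstanceAs (IsOpenImmersion (colimit.ι (Δ.diagram k) σ))

theorem map_chartι {τ σ : Δ.cones} (h : τ.1 ≤ σ.1) :
    chartMap k h ≫ Δ.chartι k σ = Δ.chartι k τ :=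
  colimit.w (Δ.diagram k) (homOfLE (show τ ≤ σ from h))

/-- The structure morphism `Y(σ) → Spec k`. -/
abbrev chartOver (σ : PointedCone ℝ (NReal M)) : chart k σ ⟶ Spec (.of k) :=
  Spec.map (CommRingCat.ofHom (algebraMap k (CoordRing k σ)))

theorem map_chartOver {τ σ : PointedCone ℝ (NReal M)} (h : τ ≤ σ) :
    chartMap k h ≫ chartOver k σ = chartOver k τ := by
  rw [chartMap, ← Spec.map_comp]
  congr 1
  ext : 1
  exact (restrict k h).comp_algebraMap

/-- The structure morphism `Y(Δ) → Spec k`. -/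
def structureMap : Δ.toricVariety k ⟶ Spec (.of k) :=
  colimit.desc (Δ.diagram k)
    { pt := Spec (.of k)
      ι := { app := fun σ => chartOver k σ.1
             naturality := fun σ τ f => by
              exact (map_chartOver k (leOfHom f)).trans (Category.comp_id _).symm } }

theorem chartι_over (σ : Δ.cones) : Δ.chartι k σ ≫ Δ.structureMap k = chartOver k σ.1 :=
  colimit.ι_desc (F := Δ.diagram k) _ _

theorem exists_lift_eq {i j : Δ.cones}
    (x : (pullback (Δ.chartι k i) (Δ.chartι k j) : Scheme.{u})) :
    ∃ (l : Δ.cones) (fi : l ⟶ i) (fj : l ⟶ j) (y : chart k l.1),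
      pullback.lift (chartMap k (leOfHom fi)) (chartMap k (leOfHom fj))
        ((Δ.map_chartι k (leOfHom fi)).trans (Δ.map_chartι k (leOfHom fj)).symm) y = x := by
  have hx : Δ.chartι k i (pullback.fst (Δ.chartι k i) (Δ.chartι k j) x) =
      Δ.chartι k j (pullback.snd (Δ.chartι k i) (Δ.chartι k j) x) := by
    rw [← Scheme.Hom.comp_apply, ← Scheme.Hom.comp_apply, pullback.condition]
  obtain ⟨l, fi, fj, y, h1, h2⟩ := (Scheme.IsLocallyDirected.ι_eq_ι_iff (Δ.diagram k)).1 hx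
  refine ⟨l, fi, fj, y, ?_⟩
  apply (pullback.fst (Δ.chartι k i) (Δ.chartι k j)).isOpenEmbedding.injective
  refine Eq.trans ?_ h1
  exact congrArg (fun g : chart k l.1 ⟶ chart k i.1 => g y) (pullback.lift_fst _ _ _)

/-- The open cover of `Y(Δ)` by the `Y(σ)`. -/
def cover : (Δ.toricVariety k).OpenCover := Scheme.IsLocallyDirected.openCover (Δ.diagram k)

instance : Category (Δ.cover k).I₀ := inferInstanceAs (Category Δ.cones)

instance : (Δ.cover k).LocallyDirected where
  trans f := (Δ.diagram k).map f
  trans_id i := (Δ.diagram k).map_id i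
  trans_comp f g := (Δ.diagram k).map_comp f g
  w f := Δ.map_chartι k (leOfHom f)
  directed x := Δ.exists_lift_eq k x
  property_trans {i j} f :=
    instIsOpenImmersionMap k Δ (σ := i) (τ := j) f

end Fan

variable (M) in
/-- The torus `T = Spec k[M]`. -/
abbrev torus : Scheme.{u} := Spec (.of (AddMonoidAlgebra k M))

variable (M) in
/-- The structure morphism `T → Spec k`. -/
abbrev torusOver : torus M k ⟶ Spec (.of k) :=
  Spec.map (CommRingCat.ofHom (algebraMap k (AddMonoidAlgebra k M)))

/-- The coaction `χ^u ↦ χ^u ⊗ χ^u` defining the action of `T` on `Y(σ)`. -/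
def coaction (σ : PointedCone ℝ (NReal M)) :
    CoordRing k σ →ₐ[k] AddMonoidAlgebra k M ⊗[k] CoordRing k σ :=
  AddMonoidAlgebra.lift k _ (dualMonoid σ)
    { toFun := fun u => AddMonoidAlgebra.single (u.toAdd : M) 1 ⊗ₜ[k]
        AddMonoidAlgebra.single u.toAdd 1
      map_one' := rfl
      map_mul' := fun u v => by
        rw [Algebra.TensorProduct.tmul_mul_tmul, AddMonoidAlgebra.single_mul_single,
          AddMonoidAlgebra.single_mul_single, mul_one]
        rfl }

theorem coaction_restrict {τ σ : PointedCone ℝ (NReal M)} (h : τ ≤ σ) :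
    (coaction k τ).comp (restrict k h) =
      (Algebra.TensorProduct.map (AlgHom.id k _) (restrict k h)).comp (coaction k σ) := by
  ext u
  simp [coaction, restrict]

/-- The action morphism `T × Y(σ) → Y(σ)`. -/
def chartAct (σ : PointedCone ℝ (NReal M)) :
    pullback (torusOver M k) (Fan.chartOver k σ) ⟶ Fan.chart k σ :=
  (pullbackSpecIso k (AddMonoidAlgebra k M) (CoordRing k σ)).hom ≫
    Spec.map (CommRingCat.ofHom (coaction k σ).toRingHom)

/-- The morphism `T × Y(τ) → T × Y(σ)` for `τ ⊆ σ`. -/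
def prodMap {τ σ : PointedCone ℝ (NReal M)} (h : τ ≤ σ) :
    pullback (torusOver M k) (Fan.chartOver k τ) ⟶ pullback (torusOver M k) (Fan.chartOver k σ) :=
  pullback.lift (pullback.fst (torusOver M k) (Fan.chartOver k τ))
    (pullback.snd (torusOver M k) (Fan.chartOver k τ) ≫ Fan.chartMap k h)
    (by rw [Category.assoc, Fan.map_chartOver, pullback.condition])

theorem chartAct_map {τ σ : PointedCone ℝ (NReal M)} (h : τ ≤ σ) :
    prodMap k h ≫ chartAct k σ = chartAct k τ ≫ Fan.chartMap k h := by
  have h1 : prodMap k h =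
      (pullbackSpecIso k (AddMonoidAlgebra k M) (CoordRing k τ)).hom ≫
      Spec.map (CommRingCat.ofHom (Algebra.TensorProduct.map (AlgHom.id k (AddMonoidAlgebra k M))
        (restrict k h)).toRingHom) ≫
      (pullbackSpecIso k (AddMonoidAlgebra k M) (CoordRing k σ)).inv := by
    rw [prodMap, ← Iso.inv_comp_eq]
    apply pullback.hom_ext
    · rw [Category.assoc, Category.assoc, pullback.lift_fst, pullbackSpecIso_inv_fst,
        pullbackSpecIso_inv_fst, ← Spec.map_comp]
      congr 1
      ext : 1
      exact congrArg AlgHom.toRingHom (Algebra.TensorProduct.map_comp_includeLeft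
        (AlgHom.id k (AddMonoidAlgebra k M)) (restrict k h)).symm
    · rw [Category.assoc, Category.assoc, pullback.lift_snd, pullbackSpecIso_inv_snd,
        ← Category.assoc, pullbackSpecIso_inv_snd, Fan.chartMap, ← Spec.map_comp, ← Spec.map_comp]
      congr 1
  rw [h1, chartAct, chartAct, Fan.chartMap, Category.assoc, Category.assoc, Category.assoc,
    Iso.inv_hom_id_assoc, ← Spec.map_comp, ← Spec.map_comp]
  congr 2
  ext : 1
  exact congrArg AlgHom.toRingHom (coaction_restrict k h).symm

namespace Fan
variable (Δ : Fan M)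

/-- The part of `T × Y(Δ)` over `Y(σ)`, as `T × Y(σ)`. -/
def toChart (σ : Δ.cones) :
    pullback (pullback.snd (torusOver M k) (Δ.structureMap k)) (Δ.chartι k σ) ⟶
      pullback (torusOver M k) (chartOver k σ.1) :=
  pullback.lift
    (pullback.fst (pullback.snd (torusOver M k) (Δ.structureMap k)) (Δ.chartι k σ) ≫
      pullback.fst (torusOver M k) (Δ.structureMap k))
    (pullback.snd (pullback.snd (torusOver M k) (Δ.structureMap k)) (Δ.chartι k σ))
    (by rw [Category.assoc, pullback.condition, ← Category.assoc, pullback.condition,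
          Category.assoc, chartι_over])

theorem toChart_map {τ σ : Δ.cones} (h : τ.1 ≤ σ.1) :
    pullback.map (pullback.snd (torusOver M k) (Δ.structureMap k)) (Δ.chartι k τ)
      (pullback.snd (torusOver M k) (Δ.structureMap k)) (Δ.chartι k σ) (𝟙 _)
      (chartMap k h) (𝟙 _) (by simp)
      (by rw [map_chartι, Category.comp_id]) ≫ Δ.toChart k σ =
    Δ.toChart k τ ≫ prodMap k h := by
  apply pullback.hom_ext
  · rw [Category.assoc, Category.assoc, toChart, toChart, prodMap, pullback.lift_fst,
      pullback.lift_fst, pullback.lift_fst, pullback.lift_fst_assoc, Category.comp_id]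
  · rw [Category.assoc, Category.assoc, toChart, toChart, prodMap, pullback.lift_snd,
      pullback.lift_snd, pullback.lift_snd, pullback.lift_snd_assoc]

theorem toChart_act {τ σ : Δ.cones} (h : τ.1 ≤ σ.1) :
    (Δ.toChart k τ ≫ prodMap k h) ≫ chartAct k σ.1 ≫ Δ.chartι k σ =
      Δ.toChart k τ ≫ chartAct k τ.1 ≫ Δ.chartι k τ := by
  have h1 := Δ.map_chartι k h
  have h2 := chartAct_map k h
  rw [Category.assoc, ← Category.assoc (prodMap k h), h2, Category.assoc, h1]

/-- The action morphism `T × Y(Δ) → Y(Δ)`, glued from the `T × Y(σ) → Y(σ)`. -/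
def act : pullback (torusOver M k) (Δ.structureMap k) ⟶ Δ.toricVariety k :=
  Scheme.OpenCover.glueMorphismsOfLocallyDirected
    ((Δ.cover k).pullback₁ (pullback.snd (torusOver M k) (Δ.structureMap k)))
    (fun σ : Δ.cones => Δ.toChart k σ ≫ chartAct k σ.1 ≫ Δ.chartι k σ)
    (fun {_ σ : Δ.cones} f =>
      (Category.assoc _ _ _).symm.trans
        ((congrArg (· ≫ chartAct k σ.1 ≫ Δ.chartι k σ) (Δ.toChart_map k (leOfHom f))).trans
          (Δ.toChart_act k (leOfHom f))))

end Fan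

variable {k}

/-- The closed subscheme `X` of `T` defined by the ideal `I`. -/
abbrev subscheme (I : Ideal (AddMonoidAlgebra k M)) : Scheme.{u} :=
  Spec (.of (AddMonoidAlgebra k M ⧸ I))

/-- The closed immersion `X → T`. -/
def subschemeι (I : Ideal (AddMonoidAlgebra k M)) : subscheme I ⟶ torus M k :=
  Spec.map (CommRingCat.ofHom (Ideal.Quotient.mk I))

/-- A scheme is of pure dimension `d` if each of its irreducible components has dimension `d`. -/
def IsPureOfDim (X : Scheme.{u}) (d : ℕ) : Prop :=
  ∀ Z ∈ irreducibleComponents X, topologicalKrullDim Z = d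

/-- The initial form `in_w f`: the sum of the terms `a_v χ^v` of `f` for which `⟨v, w⟩` is minimal. -/
def initialForm (w : NReal M) (f : AddMonoidAlgebra k M) : AddMonoidAlgebra k M :=
  open Classical in
  .ofCoeff (f.coeff.filter fun v => ∀ v' ∈ f.coeff.support, w v ≤ w v')

/-- The ideal of the initial degeneration `in_w X`, generated by the initial forms of all elements of
the ideal `I` of `X`. -/
def initialIdeal (w : NReal M) (I : Ideal (AddMonoidAlgebra k M)) : Ideal (AddMonoidAlgebra k M) :=
  Ideal.span (initialForm w '' (I : Set (AddMonoidAlgebra k M)))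

/-- For reduced `X` with ideal `I`, the ideal in `k[σ^∨ ∩ M]` of the closure `X^σ` of `X` in `Y(σ)`. -/
def closureIdeal (σ : PointedCone ℝ (NReal M)) (I : Ideal (AddMonoidAlgebra k M)) :
    Ideal (CoordRing k σ) :=
  PrimeSpectrum.vanishingIdeal
    (closure (PrimeSpectrum.comap (incl k σ).toRingHom ''
      PrimeSpectrum.zeroLocus (I : Set (AddMonoidAlgebra k M))))

namespace Fan

variable (k) in
/-- The inclusion `T → Y(Δ)`, through the chart `Y({0})`. -/
def torusι (Δ : Fan M) : torus M k ⟶ Δ.toricVariety k :=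
  Spec.map (CommRingCat.ofHom (incl k (⊥ : PointedCone ℝ (NReal M))).toRingHom) ≫
    Δ.chartι k ⟨⊥, Δ.bot_mem⟩

variable (Δ : Fan M) (I : Ideal (AddMonoidAlgebra k M))

/-- The ideal sheaf on `Y(Δ)` of the closure of `X`, with its reduced structure. -/
def closureIdealSheaf : (Δ.toricVariety k).IdealSheafData :=
  Scheme.IdealSheafData.vanishingIdeal
    ⟨closure (Set.range (subschemeι I ≫ Δ.torusι k)), isClosed_closure⟩

/-- The closure `X^Δ` of the reduced scheme `X` in `Y(Δ)`. -/
def closureScheme : Scheme.{u} := (Δ.closureIdealSheaf I).subscheme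

/-- The closed immersion `X^Δ → Y(Δ)`. -/
def closureι : Δ.closureScheme I ⟶ Δ.toricVariety k := (Δ.closureIdealSheaf I).subschemeι

/-- The multiplication map `T × X^Δ → Y(Δ)`. -/
def mult : pullback (torusOver M k) (Δ.closureι I ≫ Δ.structureMap k) ⟶ Δ.toricVariety k :=
  pullback.map (torusOver M k) (Δ.closureι I ≫ Δ.structureMap k) (torusOver M k)
    (Δ.structureMap k) (𝟙 _) (Δ.closureι I) (𝟙 _)
    (by rw [Category.comp_id, Category.id_comp]) (by rw [Category.comp_id]) ≫ Δ.act k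

/-- `Δ` is a tropical fan for the reduced closed subscheme `X` of `T` with ideal `I`: `X^Δ` is
complete and `T × X^Δ → Y(Δ)` is faithfully flat. -/
structure IsTropical : Prop where
  complete : IsProper (Δ.closureι I ≫ Δ.structureMap k)
  flat : Flat (Δ.mult I)
  surjective : Surjective (Δ.mult I)

end Fan

end Toric

end

/-!
As `X` is reduced, the ideal of `X^σ` is the contraction of the ideal `I` of `X`. Since `-u_i` is
minimal among the exponents of `f_i` on `relint σ`, it is minimal on `σ` by density, so that
`g_i = χ^{u_i} f_i` lies in `k[σ^∨ ∩ M]`. The `g_i` generate an ideal `J` contained in the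
contraction, and equality may be checked locally at each maximal ideal `p`.

The characters outside `p` are those vanishing on some face `τ` of `σ`, and inverting one of them
turns `k[σ^∨ ∩ M]` into `k[τ^∨ ∩ M]`. Filter the latter by the weights of a lattice point `ν` in the
relative interior of `τ`. Since the `g_i` have nonzero constant term, their initial forms are
supported on the units of `τ^∨ ∩ M`, so the hypothesis on initial ideals gives, one weight at a
time, `h ∈ J + 𝔫_N` for every `h` in the contraction and every `N`, where `𝔫_N` is the ideal of the
elements of weight at least `N`. These ideals are cofinal with the powers of `𝔫_1`, and Krull's
intersection theorem gives `(1 - r) h ∈ J` with `r ∈ 𝔫_1`. The characters of positive weight all lie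
in `p`, so `1 - r` is invertible at `p`.
-/

noncomputable section

namespace Toric

/-! ### Commutative algebra, convexity and monoid algebras -/

theorem exists_one_sub_mul_mem_of_forall_mem_sup_pow {R : Type*} [CommRing R] [IsNoetherianRing R]
    {J 𝔫 : Ideal R} {h : R} (hh : ∀ N : ℕ, h ∈ J ⊔ 𝔫 ^ N) : ∃ r ∈ 𝔫, (1 - r) * h ∈ J := by
  have hmk : (Ideal.Quotient.mk J h : R ⧸ J) ∈ (⨅ N : ℕ, 𝔫 ^ N • ⊤ : Submodule R (R ⧸ J)) := by
    rw [Submodule.mem_iInf]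
    intro N
    obtain ⟨a, ha, b, hb, rfl⟩ := Submodule.mem_sup.1 (hh N)
    rw [map_add, Ideal.Quotient.eq_zero_iff_mem.2 ha, zero_add]
    simpa [Algebra.smul_def] using
      Submodule.smul_mem_smul hb (Submodule.mem_top (x := (1 : R ⧸ J)))
  obtain ⟨⟨r, hr⟩, hrh⟩ := (Ideal.mem_iInf_smul_pow_eq_bot_iff 𝔫 _).1 hmk
  refine ⟨r, hr, Ideal.Quotient.eq_zero_iff_mem.1 ?_⟩
  have hrh' : Ideal.Quotient.mk J r * Ideal.Quotient.mk J h = Ideal.Quotient.mk J h := hrh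
  rw [map_mul, map_sub, map_one, sub_mul, one_mul, hrh', sub_self]

theorem mem_of_forall_isMaximal_exists_mul_mem {R : Type*} [CommRing R] {J : Ideal R} {h : R}
    (H : ∀ p : Ideal R, p.IsMaximal → ∃ t ∉ p, t * h ∈ J) : h ∈ J := by
  refine Submodule.mem_of_span_top_of_smul_mem J {t | t * h ∈ J} ?_ h fun t => t.2
  by_contra hne
  obtain ⟨p, hp, hle⟩ := Ideal.exists_le_maximal _ hne
  obtain ⟨t, htp, hth⟩ := H p hp
  exact htp (hle (Ideal.subset_span hth))

theorem exists_algebraMap_eq_pow_mul_and_mul_mem {R S : Type*} [CommRing R] [CommRing S]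
    [Algebra R S] (x : R) [IsLocalization.Away x S] {J : Ideal R} {h : R} {z : S}
    (hz : z * algebraMap R S h ∈ J.map (algebraMap R S)) :
    ∃ (n : ℕ) (t : R), algebraMap R S t = algebraMap R S x ^ n * z ∧ t * h ∈ J := by
  obtain ⟨n, a, ha⟩ := IsLocalization.Away.surj x z
  have hah : algebraMap R S (a * h) ∈ J.map (algebraMap R S) := by
    rw [map_mul, ← ha, mul_right_comm]
    exact Ideal.mul_mem_right _ _ hz
  obtain ⟨_, ⟨m, rfl⟩, hm⟩ :=
    (IsLocalization.algebraMap_mem_map_algebraMap_iff (Submonoid.powers x) S J _).1 hah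
  refine ⟨m + n, x ^ m * a, ?_, by rwa [mul_assoc]⟩
  rw [map_mul, map_pow, ← ha]
  ring

theorem intrinsicInterior_nonempty_of_convex {E : Type*} [AddCommGroup E] [Module ℝ E]
    [TopologicalSpace E] [IsTopologicalAddGroup E] [ContinuousSMul ℝ E] [T2Space E]
    [FiniteDimensional ℝ E] {s : Set E} (hs : Convex ℝ s) (hne : s.Nonempty) :
    (intrinsicInterior ℝ s).Nonempty := by
  let e : E ≃L[ℝ] (Fin (Module.finrank ℝ E) → ℝ) := .ofFinrankEq (by simp)
  have himage : (intrinsicInterior ℝ (e.toContinuousAffineEquiv '' s)).Nonempty :=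
    (hne.image e).intrinsicInterior (hs.linear_image e.toLinearMap)
  rw [e.toContinuousAffineEquiv.intrinsicInterior_image] at himage
  exact himage.of_image

theorem fg_comap_nonneg {G ι : Type*} [AddCommMonoid G] [AddMonoid.FG G] [Finite ι]
    (ℓ : G →+ (ι → ℤ)) : ((AddSubmonoid.nonneg (ι → ℤ)).comap ℓ).FG := by
  obtain ⟨n, φ, hφ⟩ := Module.Finite.exists_fin' ℕ G
  -- The pairs `(x, y)` with `ℓ (φ x) = y` form an equalizer, hence are finitely generated.
  let p : (Fin n → ℕ) × (ι → ℕ) →+ G := φ.toAddMonoidHom.comp (AddMonoidHom.fst _ _)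
  let q : (Fin n → ℕ) × (ι → ℕ) →+ (ι → ℤ) :=
    ((Nat.castAddMonoidHom ℤ).compLeft ι).comp (AddMonoidHom.snd _ _)
  convert (AddSubmonoid.fg_eqLocusM (ℓ.comp p) q).map p
  ext u
  constructor
  · intro hu
    obtain ⟨x, rfl⟩ := hφ u
    exact ⟨(x, fun i => (ℓ (φ x) i).toNat), funext fun i => (Int.toNat_of_nonneg (hu i)).symm, rfl⟩
  · rintro ⟨x, hx, rfl⟩ i
    exact (congrFun hx i).ge.trans' (Int.natCast_nonneg _)

section MonoidAlgebra

variable {R G : Type*} [Semiring R]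

theorem mem_support_single_one_mul [AddCommGroup G] {u v : G} {a : AddMonoidAlgebra R G} :
    v ∈ (AddMonoidAlgebra.single u 1 * a).coeff.support ↔ v - u ∈ a.coeff.support := by
  simp [sub_eq_neg_add]

open Classical in
/-- The part of `a` supported on `P`. Its use is to cut down the coefficients of a linear
combination; `truncate_mul` says when this is compatible with the products. -/
def truncate (P : Set G) : AddMonoidAlgebra R G →+ AddMonoidAlgebra R G where
  toFun a := .ofCoeff (a.coeff.filter (· ∈ P))
  map_zero' := congrArg AddMonoidAlgebra.ofCoeff (Finsupp.filter_zero _)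
  map_add' _ _ := congrArg AddMonoidAlgebra.ofCoeff Finsupp.filter_add

theorem mem_support_truncate {P : Set G} {a : AddMonoidAlgebra R G} {v : G} :
    v ∈ (truncate P a).coeff.support ↔ v ∈ a.coeff.support ∧ v ∈ P := by
  classical
  change v ∈ (a.coeff.filter (· ∈ P)).support ↔ _
  rw [Finsupp.support_filter, Finset.mem_filter]

theorem truncate_eq_self {P : Set G} {a : AddMonoidAlgebra R G}
    (ha : ∀ v ∈ a.coeff.support, v ∈ P) : truncate P a = a := by
  classical
  exact congrArg AddMonoidAlgebra.ofCoeff ((Finsupp.filter_eq_self_iff _ _).2 fun v hv =>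
    ha v (Finsupp.mem_support_iff.2 hv))

theorem truncate_mul [AddGroup G] {P : Set G} (a : AddMonoidAlgebra R G)
    {b : AddMonoidAlgebra R G} (hb : ∀ y ∈ b.coeff.support, ∀ v, v + y ∈ P ↔ v ∈ P) :
    truncate P (a * b) = truncate P a * b := by
  classical
  ext v
  have hsub (y) (hy : y ∈ b.coeff.support) : v + -y ∈ P ↔ v ∈ P := by
    simpa using (hb y hy (v + -y)).symm
  rw [AddMonoidAlgebra.coeff_mul_apply_right]
  change (a * b).coeff.filter (· ∈ P) v = b.coeff.sum fun y r => a.coeff.filter (· ∈ P) (v + -y) * r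
  simp only [AddMonoidAlgebra.coeff_mul_apply_right, Finsupp.filter_apply]
  split_ifs with hv
  · exact Finset.sum_congr rfl fun y hy => by simp only [if_pos ((hsub y hy).2 hv)]
  · exact (Finset.sum_eq_zero fun y hy => by
      simp only [if_neg (mt (hsub y hy).1 hv), zero_mul]).symm

end MonoidAlgebra

theorem span_range_single_one_mul {R G κ : Type*} [CommRing R] [AddCommGroup G] (u : κ → G)
    (a : κ → AddMonoidAlgebra R G) :
    Ideal.span (Set.range fun i => AddMonoidAlgebra.single (u i) 1 * a i) =
      Ideal.span (Set.range a) := by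
  have hunit (i) : IsUnit (AddMonoidAlgebra.single (u i) 1 : AddMonoidAlgebra R G) :=
    .of_mul_eq_one (AddMonoidAlgebra.single (-u i) 1)
      (by simp [AddMonoidAlgebra.single_mul_single, AddMonoidAlgebra.one_def])
  simp only [Ideal.span, Submodule.span_range_eq_iSup]
  exact iSup_congr fun i => Ideal.span_singleton_mul_left_unit (hunit i) _

/-! ### Supports and initial forms -/

variable {k M : Type u} [Field k] [AddCommGroup M] {σ τ : PointedCone ℝ (NReal M)}
  {κ : Type*} {I : Ideal (AddMonoidAlgebra k M)} {ν : M →ₗ[ℤ] ℤ}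

theorem mem_support_initialForm {w : NReal M} {f : AddMonoidAlgebra k M} {v : M} :
    v ∈ (initialForm w f).coeff.support ↔
      v ∈ f.coeff.support ∧ ∀ v' ∈ f.coeff.support, w v ≤ w v' := by
  classical
  simp only [initialForm, AddMonoidAlgebra.coeff_ofCoeff, Finsupp.support_filter,
    Finset.mem_filter]

theorem mem_support_sub_initialForm {w : NReal M} {f : AddMonoidAlgebra k M} {v : M} :
    v ∈ (f - initialForm w f).coeff.support ↔
      v ∈ f.coeff.support ∧ ∃ v' ∈ f.coeff.support, w v' < w v := by
  classical
  have hcoeff : (f - initialForm w f).coeff v =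
      if ∀ v' ∈ f.coeff.support, w v ≤ w v' then 0 else f.coeff v := by
    simp only [initialForm, AddMonoidAlgebra.coeff_sub, Finsupp.sub_apply,
      Finsupp.filter_apply]
    split_ifs <;> simp
  rw [Finsupp.mem_support_iff, hcoeff, ite_ne_left_iff, Finsupp.mem_support_iff]
  push Not
  tauto

theorem initialForm_single_one_mul (w : NReal M) (u : M) (f : AddMonoidAlgebra k M) :
    initialForm w (AddMonoidAlgebra.single u 1 * f) =
      AddMonoidAlgebra.single u 1 * initialForm w f := by
  classical
  ext v
  have hmin : (∀ v' ∈ (AddMonoidAlgebra.single u 1 * f).coeff.support, w v ≤ w v') ↔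
      ∀ v' ∈ f.coeff.support, w (-u + v) ≤ w v' := by
    simp only [mem_support_single_one_mul, map_add, map_neg, neg_add_le_iff_le_add]
    exact ⟨fun h v' hv' => by simpa using h (u + v') (by simpa using hv'),
      fun h v' hv' => by simpa using h _ hv'⟩
  simp only [initialForm, AddMonoidAlgebra.coeff_ofCoeff, Finsupp.filter_apply, hmin,
    AddMonoidAlgebra.coeff_single_mul_apply, one_mul]

theorem incl_injective (σ : PointedCone ℝ (NReal M)) : Function.Injective (incl k σ) :=
  AddMonoidAlgebra.mapDomain_injective Subtype.val_injective

theorem incl_single (v : dualMonoid σ) (r : k) :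
    incl k σ (AddMonoidAlgebra.single v r) = AddMonoidAlgebra.single (v : M) r :=
  AddMonoidAlgebra.mapDomain_single

theorem mem_support_incl {a : CoordRing k σ} {v : M} :
    v ∈ (incl k σ a).coeff.support ↔ ∃ h : v ∈ dualMonoid σ, ⟨v, h⟩ ∈ a.coeff.support := by
  classical
  change v ∈ (Finsupp.mapDomain Subtype.val a.coeff).support ↔ _
  rw [Finsupp.mapDomain_support_of_injective Subtype.val_injective]
  simp [-Finsupp.mem_support_iff]

theorem exists_incl_eq {p : AddMonoidAlgebra k M} (hp : ∀ v ∈ p.coeff.support, v ∈ dualMonoid σ) :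
    ∃ a, incl k σ a = p := by
  classical
  refine ⟨∑ v ∈ p.coeff.support.attach,
    AddMonoidAlgebra.single ⟨v.1, hp _ v.2⟩ (p.coeff v.1), ?_⟩
  rw [map_sum]
  simp only [incl_single]
  rw [Finset.sum_attach p.coeff.support fun v => AddMonoidAlgebra.single v (p.coeff v)]
  exact p.sum_coeff_single

theorem incl_restrict (h : τ ≤ σ) (a : CoordRing k σ) : incl k τ (restrict k h a) = incl k σ a := by
  have hcomp : (incl k τ).comp (restrict k h) = incl k σ := by
    ext
    simp [incl, restrict]
  exact DFunLike.congr_fun hcomp a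

theorem closureIdeal_eq_comap_incl (hI : I.IsRadical) :
    closureIdeal σ I = I.comap (incl k σ) := by
  ext a
  rw [closureIdeal, PrimeSpectrum.vanishingIdeal_closure, PrimeSpectrum.mem_vanishingIdeal,
    Set.forall_mem_image, Ideal.mem_comap]
  conv_rhs => rw [← hI.radical, ← PrimeSpectrum.vanishingIdeal_zeroLocus_eq_radical,
    PrimeSpectrum.mem_vanishingIdeal]
  rfl

theorem latticeVector_apply (ν : M →ₗ[ℤ] ℤ) (u : M) : latticeVector ν u = (ν u : ℝ) := rfl

/-! ### Cones and their dual monoids -/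

theorem mem_dualMonoid_hull {s : Set (M →ₗ[ℤ] ℤ)} {u : M} :
    u ∈ dualMonoid (PointedCone.hull ℝ (latticeVector '' s)) ↔ ∀ v ∈ s, 0 ≤ v u := by
  constructor
  · intro hu v hv
    exact Int.cast_nonneg_iff.1 (hu _ (Submodule.subset_span ⟨v, hv, rfl⟩))
  · intro hu w hw
    induction hw using Submodule.span_induction with
    | mem x hx =>
      obtain ⟨v, hv, rfl⟩ := hx
      exact Int.cast_nonneg (hu v hv)
    | zero => simp
    | add x y _ _ hx hy => exact add_nonneg hx hy
    | smul a x _ hx => exact mul_nonneg a.2 hx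

theorem IsCone.fg_dualMonoid [Module.Finite ℤ M] (hσ : IsCone σ) :
    AddMonoid.FG (dualMonoid σ) := by
  have : AddMonoid.FG M := AddGroup.fg_iff_addMonoid_fg.1 (Module.Finite.iff_addGroup_fg.1 ‹_›)
  obtain ⟨s, rfl⟩ := hσ.rational
  have hcomap : dualMonoid (PointedCone.hull ℝ (latticeVector '' s)) =
      (AddSubmonoid.nonneg (s → ℤ)).comap (AddMonoidHom.pi fun v : s => v.1.toAddMonoidHom) := by
    ext u
    simp [mem_dualMonoid_hull, Pi.le_def]
  rw [AddMonoid.fg_iff_addSubmonoid_fg, hcomap]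
  exact fg_comap_nonneg _

variable (k) in
theorem IsCone.isNoetherianRing_coordRing [Module.Finite ℤ M] (hσ : IsCone σ) :
    IsNoetherianRing (CoordRing k σ) := by
  have := hσ.fg_dualMonoid
  exact Algebra.FiniteType.isNoetherianRing k _

theorem exists_isFace_forall_mem_iff {m : M} (hm : m ∈ dualMonoid σ) :
    ∃ τ, IsFace τ σ ∧ ∀ w, w ∈ τ ↔ w ∈ σ ∧ w m = 0 := by
  let τ : PointedCone ℝ (NReal M) :=
    { carrier := {w | w ∈ σ ∧ w m = 0}
      add_mem' := fun ⟨ha, ha0⟩ ⟨hb, hb0⟩ => ⟨add_mem ha hb, by simp [ha0, hb0]⟩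
      zero_mem' := ⟨zero_mem σ, rfl⟩
      smul_mem' := fun a w ⟨hw, hw0⟩ =>
        ⟨Submodule.smul_mem σ a hw, (congrArg (fun x => (a : ℝ) * x) hw0).trans (mul_zero _)⟩ }
  exact ⟨τ, ⟨m, hm, fun _ => Iff.rfl⟩, fun _ => Iff.rfl⟩

theorem mem_hull_filter_of_apply_eq_zero {s : Finset (M →ₗ[ℤ] ℤ)} {m : M} {w : NReal M}
    (hm : m ∈ dualMonoid (PointedCone.hull ℝ (latticeVector '' (s : Set (M →ₗ[ℤ] ℤ)))))
    (hw : w ∈ PointedCone.hull ℝ (latticeVector '' (s : Set (M →ₗ[ℤ] ℤ)))) (hwm : w m = 0) :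
    w ∈ PointedCone.hull ℝ (latticeVector '' (s.filter (· m = 0) : Set (M →ₗ[ℤ] ℤ))) := by
  induction hw using Submodule.span_induction with
  | mem x hx =>
    obtain ⟨v, hv, rfl⟩ := hx
    exact Submodule.subset_span
      ⟨v, Finset.mem_filter.2 ⟨hv, Int.cast_eq_zero.1 hwm⟩, rfl⟩
  | zero => exact zero_mem _
  | add x y hx hy ihx ihy =>
    have hsum : x m + y m = 0 := hwm
    have hxm := hm x hx
    have hym := hm y hy
    exact add_mem (ihx (by linarith)) (ihy (by linarith))
  | smul a x _ ih =>
    rcases mul_eq_zero.1 (show (a : ℝ) * x m = 0 from hwm) with ha | hxm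
    · obtain rfl : a = 0 := Subtype.ext ha
      simp
    · exact Submodule.smul_mem _ a (ih hxm)

theorem IsCone.of_isFace (hσ : IsCone σ) (h : IsFace τ σ) : IsCone τ := by
  obtain ⟨m, hm, hτ⟩ := h
  obtain ⟨s, hs⟩ := hσ.rational
  have hτσ : τ ≤ σ := fun w hw => ((hτ w).1 hw).1
  refine ⟨⟨s.filter (· m = 0), le_antisymm (fun w hw => ?_) (Submodule.span_le.2 ?_)⟩,
    fun w hw h0 hneg => hσ.pointed w (hτσ hw) h0 (hτσ hneg)⟩
  · obtain ⟨hwσ, hwm⟩ := (hτ w).1 hw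
    rw [hs] at hwσ
    exact mem_hull_filter_of_apply_eq_zero (hs ▸ hm) hwσ hwm
  · rintro _ ⟨v, hv, rfl⟩
    obtain ⟨hvs, hvm⟩ := Finset.mem_filter.1 hv
    exact (hτ _).2 ⟨hs ▸ Submodule.subset_span ⟨v, hvs, rfl⟩, by simp [latticeVector_apply, hvm]⟩

theorem IsCone.exists_latticeVector_mem (hσ : IsCone σ) :
    ∃ ν : M →ₗ[ℤ] ℤ, latticeVector ν ∈ σ ∧ ∀ u ∈ dualMonoid σ, ν u = 0 → -u ∈ dualMonoid σ := by
  obtain ⟨s, rfl⟩ := hσ.rational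
  refine ⟨∑ v ∈ s, v, ?_, fun u hu h0 => ?_⟩
  · have hsum : latticeVector (∑ v ∈ s, v) = ∑ v ∈ s, latticeVector v := by
      ext u
      simp [latticeVector_apply]
    exact hsum ▸ Submodule.sum_mem _ fun v hv => Submodule.subset_span ⟨v, hv, rfl⟩
  · rw [mem_dualMonoid_hull] at hu ⊢
    rw [LinearMap.sum_apply, Finset.sum_eq_zero_iff_of_nonneg hu] at h0
    exact fun v hv => by simp [h0 v hv]

/-! ### Relative interiors -/

instance : IsTopologicalAddGroup (NReal M) :=
  topologicalAddGroup_induced (LinearMap.ltoFun ℤ M ℝ ℤ)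

instance : ContinuousSMul ℝ (NReal M) :=
  continuousSMul_induced (LinearMap.ltoFun ℤ M ℝ ℝ)

instance : T2Space (NReal M) :=
  .of_injective_continuous (f := fun (w : NReal M) (u : M) => w u) DFunLike.coe_injective
    continuous_induced_dom

instance [Module.Finite ℤ M] : FiniteDimensional ℝ (NReal M) := by
  obtain ⟨n, φ, hφ⟩ := Module.Finite.exists_fin' ℤ M
  exact .of_injective (LinearMap.lcomp ℝ ℝ φ) fun v w h => LinearMap.cancel_right hφ |>.1 h

theorem relint_nonempty [Module.Finite ℤ M] (σ : PointedCone ℝ (NReal M)) :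
    (relint σ).Nonempty :=
  intrinsicInterior_nonempty_of_convex (PointedCone.convex σ) ⟨0, zero_mem σ⟩

theorem add_mem_relint {w₀ w : NReal M} (hw₀ : w₀ ∈ relint σ) (hw : w ∈ σ) :
    w + w₀ ∈ relint σ := by
  obtain ⟨x, hx, rfl⟩ := mem_intrinsicInterior.1 hw₀
  have hdir : w ∈ (affineSpan ℝ (σ : Set (NReal M))).direction := by
    simpa using AffineSubspace.vsub_mem_direction (subset_affineSpan ℝ _ hw)
      (subset_affineSpan ℝ _ (zero_mem σ))
  let T : affineSpan ℝ (σ : Set (NReal M)) → affineSpan ℝ (σ : Set (NReal M)) := fun y =>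
    ⟨-w +ᵥ (y : NReal M), AffineSubspace.vadd_mem_of_mem_direction (neg_mem hdir) y.2⟩
  have hT : Continuous T := (continuous_subtype_val.const_vadd (-w)).subtype_mk _
  have hwx : w + x ∈ affineSpan ℝ (σ : Set (NReal M)) :=
    AffineSubspace.vadd_mem_of_mem_direction hdir x.2
  refine mem_intrinsicInterior.2 ⟨⟨w + x, hwx⟩, mem_interior.2
    ⟨T ⁻¹' interior (Subtype.val ⁻¹' (σ : Set (NReal M))), fun y hy => ?_,
      isOpen_interior.preimage hT, ?_⟩, rfl⟩
  · have hTy : T y ∈ Subtype.val ⁻¹' (σ : Set (NReal M)) := interior_subset hy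
    simpa [T] using add_mem hw hTy
  · simpa [T] using hx

theorem sub_mem_dualMonoid_of_forall_relint_le [Module.Finite ℤ M] {v v' : M}
    (h : ∀ w ∈ relint σ, w v ≤ w v') : v' - v ∈ dualMonoid σ := by
  obtain ⟨w₀, hw₀⟩ := relint_nonempty σ
  intro w hw
  by_contra! hneg
  obtain ⟨n, hn⟩ := Archimedean.arch (w₀ (v' - v) + 1) (neg_pos.2 hneg)
  have hle := h _ (add_mem_relint hw₀ (nsmul_mem hw n))
  simp only [LinearMap.add_apply, LinearMap.smul_apply, smul_neg, map_sub, smul_sub] at hle hn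
  linarith

/-! ### The filtration by weight -/

variable (k τ) in
/-- The ideal of `k[τ^∨ ∩ M]` spanned by the `χ^u` with `⟨u, ν⟩ ≥ c`; these ideals form a filtration
whose graded pieces are read off by the initial forms with respect to `ν`. -/
def weightIdeal (ν : M →ₗ[ℤ] ℤ) (c : ℕ) : Ideal (CoordRing k τ) :=
  Ideal.span (AddMonoidAlgebra.of' k (dualMonoid τ) '' {u | (c : ℤ) ≤ ν u})

theorem mem_weightIdeal (hν : latticeVector ν ∈ τ) {c : ℕ} {a : CoordRing k τ} :
    a ∈ weightIdeal k τ ν c ↔ ∀ v ∈ (incl k τ a).coeff.support, (c : ℤ) ≤ ν v := by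
  have hnonneg (v : dualMonoid τ) : 0 ≤ ν v := Int.cast_nonneg_iff.1 (v.2 _ hν)
  rw [weightIdeal, AddMonoidAlgebra.mem_ideal_span_of'_image]
  constructor
  · intro h v hv
    obtain ⟨hvτ, hva⟩ := mem_support_incl.1 hv
    obtain ⟨u, hu, d, hd⟩ := h _ hva
    have hvdu : v = d + u := congrArg Subtype.val hd
    rw [hvdu, map_add]
    linarith [hnonneg d, show (c : ℤ) ≤ ν u from hu]
  · exact fun h v hv => ⟨v, h v (mem_support_incl.2 ⟨v.2, hv⟩), 0, (zero_add v).symm⟩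

theorem single_mem_weightIdeal {u : dualMonoid τ} {c : ℕ} (hu : (c : ℤ) ≤ ν u) :
    AddMonoidAlgebra.single u 1 ∈ weightIdeal k τ ν c :=
  Ideal.subset_span ⟨u, hu, rfl⟩

theorem restrict_mem_weightIdeal (h : τ ≤ σ) (hν : latticeVector ν ∈ τ) {c : ℕ}
    {a : CoordRing k σ} : restrict k h a ∈ weightIdeal k τ ν c ↔ a ∈ weightIdeal k σ ν c := by
  rw [mem_weightIdeal hν, mem_weightIdeal (h hν), incl_restrict]

theorem weightIdeal_zero : weightIdeal k τ ν 0 = ⊤ :=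
  (Ideal.eq_top_iff_one _).2 (single_mem_weightIdeal (by simp))

theorem weightIdeal_mul_weightIdeal_le (b c : ℕ) :
    weightIdeal k τ ν b * weightIdeal k τ ν c ≤ weightIdeal k τ ν (b + c) := by
  rw [weightIdeal, weightIdeal, Ideal.span_mul_span', Ideal.span_le]
  rintro _ ⟨_, ⟨u, hu, rfl⟩, _, ⟨v, hv, rfl⟩, rfl⟩
  have huv : ((b + c : ℕ) : ℤ) ≤ ν (u + v : dualMonoid τ) := by
    have hu' : (b : ℤ) ≤ ν u := hu
    have hv' : (c : ℤ) ≤ ν v := hv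
    push_cast
    rw [map_add]
    exact add_le_add hu' hv'
  simpa [AddMonoidAlgebra.of'_apply, AddMonoidAlgebra.single_mul_single]
    using single_mem_weightIdeal (k := k) huv

theorem exists_sub_mem_weightIdeal_succ (hν : latticeVector ν ∈ τ) {c : ℕ} {h : CoordRing k τ}
    (hh : h ∈ weightIdeal k τ ν c) :
    ∃ h₀ ∈ weightIdeal k τ ν c, incl k τ h₀ = initialForm (latticeVector ν) (incl k τ h) ∧
      h - h₀ ∈ weightIdeal k τ ν (c + 1) := by
  rw [mem_weightIdeal hν] at hh
  obtain ⟨h₀, hh₀⟩ := exists_incl_eq (σ := τ)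
    (p := initialForm (latticeVector ν) (incl k τ h)) fun v hv =>
      (mem_support_incl.1 (mem_support_initialForm.1 hv).1).1
  refine ⟨h₀, (mem_weightIdeal hν).2 fun v hv => ?_, hh₀, (mem_weightIdeal hν).2 fun v hv => ?_⟩
  · exact hh v (mem_support_initialForm.1 (hh₀ ▸ hv)).1
  · rw [map_sub, hh₀, mem_support_sub_initialForm] at hv
    obtain ⟨-, v', hv', hlt⟩ := hv
    have hlt' : ν v' < ν v := Int.cast_lt.1 hlt
    push_cast
    linarith [hh v' hv']

-- Translation by the exponents of the `a l`, which are units of weight zero, preserves `P`, so that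
-- truncating the coefficients of a relation to `P` preserves the relation.
theorem mem_weightIdeal_mul_span_range (hν : latticeVector ν ∈ τ) {a : κ → CoordRing k τ}
    (ha : ∀ l, ∀ y ∈ (incl k τ (a l)).coeff.support, ν y = 0 ∧ -y ∈ dualMonoid τ) {c : ℕ}
    {x : CoordRing k τ} (hx : x ∈ weightIdeal k τ ν c)
    (hxspan : incl k τ x ∈ Ideal.span (Set.range fun l => incl k τ (a l))) :
    x ∈ weightIdeal k τ ν c * Ideal.span (Set.range a) := by
  obtain ⟨b, hb⟩ := Finsupp.mem_ideal_span_range_iff_exists_finsupp.1 hxspan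
  let P : Set M := {v | v ∈ dualMonoid τ ∧ (c : ℤ) ≤ ν v}
  have hP (l) (y) (hy : y ∈ (incl k τ (a l)).coeff.support) (v : M) : v + y ∈ P ↔ v ∈ P := by
    obtain ⟨hνy, hneg⟩ := ha l y hy
    have hyτ := (mem_support_incl.1 hy).1
    have hmem : v + y ∈ dualMonoid τ ↔ v ∈ dualMonoid τ :=
      ⟨fun h => by simpa using add_mem h hneg, fun h => add_mem h hyτ⟩
    simp only [P, Set.mem_ofPred_eq, hmem, map_add, hνy, add_zero]
  have hlift (l) : ∃ b', incl k τ b' = truncate P (b l) :=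
    exists_incl_eq fun v hv => (mem_support_truncate.1 hv).2.1
  choose b' hb' using hlift
  have hb'mem (l) : b' l ∈ weightIdeal k τ ν c := (mem_weightIdeal hν).2 fun v hv =>
    (mem_support_truncate.1 (hb' l ▸ hv)).2.2
  have hxP : truncate P (incl k τ x) = incl k τ x := truncate_eq_self fun v hv =>
    ⟨(mem_support_incl.1 hv).1, (mem_weightIdeal hν).1 hx v hv⟩
  have hxsum : x = b.sum fun l _ => b' l * a l := by
    apply incl_injective
    rw [← hxP, ← hb, map_finsuppSum, map_finsuppSum]
    exact Finsupp.sum_congr fun l _ => by rw [truncate_mul _ (hP l), map_mul, hb']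
  rw [hxsum]
  exact Ideal.sum_mem _ fun l _ => Ideal.mul_mem_mul (hb'mem l) (Ideal.subset_span ⟨l, rfl⟩)

theorem mem_span_range_sup_weightIdeal_succ (hν : latticeVector ν ∈ τ)
    (hint : ∀ u ∈ dualMonoid τ, ν u = 0 → -u ∈ dualMonoid τ) {g : κ → CoordRing k τ}
    (hg : ∀ l, 0 ∈ (incl k τ (g l)).coeff.support) {c : ℕ} {h : CoordRing k τ}
    (hh : h ∈ weightIdeal k τ ν c)
    (hspan : initialForm (latticeVector ν) (incl k τ h) ∈
      Ideal.span (Set.range fun l => initialForm (latticeVector ν) (incl k τ (g l)))) :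
    h ∈ Ideal.span (Set.range g) ⊔ weightIdeal k τ ν (c + 1) := by
  have htop (l) : g l ∈ weightIdeal k τ ν 0 := weightIdeal_zero.ge Submodule.mem_top
  choose g₀ _ hg₀ hgsub using fun l => exists_sub_mem_weightIdeal_succ hν (htop l)
  obtain ⟨h₀, hh₀, hh₀init, hhsub⟩ := exists_sub_mem_weightIdeal_succ hν hh
  have hg₀supp (l) (y) (hy : y ∈ (incl k τ (g₀ l)).coeff.support) :
      ν y = 0 ∧ -y ∈ dualMonoid τ := by
    rw [hg₀, mem_support_initialForm] at hy
    have hyτ := (mem_support_incl.1 hy.1).1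
    have hle : ν y ≤ 0 := by simpa [latticeVector_apply] using hy.2 0 (hg l)
    have hνy : ν y = 0 := le_antisymm hle (Int.cast_nonneg_iff.1 (hyτ _ hν))
    exact ⟨hνy, hint y hyτ hνy⟩
  have hg₀span : Ideal.span (Set.range g₀) ≤ Ideal.span (Set.range g) ⊔ weightIdeal k τ ν 1 := by
    rw [Ideal.span_le]
    rintro _ ⟨l, rfl⟩
    rw [← sub_sub_cancel (g l) (g₀ l)]
    exact sub_mem (Ideal.mem_sup_left (Ideal.subset_span ⟨l, rfl⟩))
      (Ideal.mem_sup_right (hgsub l))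
  have hh₀mem : h₀ ∈ weightIdeal k τ ν c * Ideal.span (Set.range g₀) := by
    refine mem_weightIdeal_mul_span_range hν hg₀supp hh₀ ?_
    simpa only [hg₀, hh₀init] using hspan
  have hle : weightIdeal k τ ν c * Ideal.span (Set.range g₀) ≤
      Ideal.span (Set.range g) ⊔ weightIdeal k τ ν (c + 1) :=
    calc weightIdeal k τ ν c * Ideal.span (Set.range g₀)
        ≤ weightIdeal k τ ν c * (Ideal.span (Set.range g) ⊔ weightIdeal k τ ν 1) :=
          Ideal.mul_mono_right hg₀span
      _ = weightIdeal k τ ν c * Ideal.span (Set.range g) ⊔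
            weightIdeal k τ ν c * weightIdeal k τ ν 1 := Ideal.mul_sup _ _ _
      _ ≤ _ := sup_le_sup Ideal.mul_le_right (weightIdeal_mul_weightIdeal_le c 1)
  rw [← sub_add_cancel h h₀]
  exact add_mem (Ideal.mem_sup_right hhsub) (hle hh₀mem)

theorem mem_span_range_sup_weightIdeal (hν : latticeVector ν ∈ τ)
    (hint : ∀ u ∈ dualMonoid τ, ν u = 0 → -u ∈ dualMonoid τ) {g : κ → CoordRing k τ}
    (hg : ∀ l, 0 ∈ (incl k τ (g l)).coeff.support) (hgI : ∀ l, incl k τ (g l) ∈ I)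
    (hgen : initialIdeal (latticeVector ν) I ≤
      Ideal.span (Set.range fun l => initialForm (latticeVector ν) (incl k τ (g l))))
    {h : CoordRing k τ} (hh : incl k τ h ∈ I) (c : ℕ) :
    h ∈ Ideal.span (Set.range g) ⊔ weightIdeal k τ ν c := by
  induction c with
  | zero => exact Ideal.mem_sup_right (weightIdeal_zero.ge Submodule.mem_top)
  | succ c ih =>
    obtain ⟨a, ha, b, hb, rfl⟩ := Submodule.mem_sup.1 ih
    have hspanI : Ideal.span (Set.range g) ≤ I.comap (incl k τ) :=
      Ideal.span_le.2 (Set.range_subset_iff.2 hgI)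
    have hbI : incl k τ b ∈ I := by simpa using sub_mem hh (hspanI ha)
    exact add_mem (Ideal.mem_sup_left ha) <|
      mem_span_range_sup_weightIdeal_succ hν hint hg hb (hgen (Ideal.subset_span ⟨_, hbI, rfl⟩))

/-! ### Generation at a prime ideal -/

-- A generator of `τ^∨ ∩ M` has weight at most `D`, so a monomial of weight at least `D * N` is a
-- product of generators of which at least `N` have positive weight.
theorem IsCone.exists_weightIdeal_mul_le_pow [Module.Finite ℤ M] (hτ : IsCone τ) (ν : M →ₗ[ℤ] ℤ) :
    ∃ D : ℕ, ∀ N : ℕ, weightIdeal k τ ν (D * N) ≤ weightIdeal k τ ν 1 ^ N := by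
  obtain ⟨S, hS⟩ := hτ.fg_dualMonoid.fg_top
  let D : ℕ := S.sup (fun u => (ν u).toNat) + 1
  have hpow (u : dualMonoid τ) :
      ∃ c : ℕ, AddMonoidAlgebra.single u 1 ∈ weightIdeal k τ ν 1 ^ c ∧ ν u ≤ D * c := by
    induction (hS ▸ AddSubmonoid.mem_top u : u ∈ AddSubmonoid.closure S)
      using AddSubmonoid.closure_induction with
    | mem u hu =>
      have huD : (ν u).toNat ≤ D :=
        (Finset.le_sup (f := fun u : dualMonoid τ => (ν u).toNat) hu).trans (Nat.le_succ _)
      by_cases hνu : 1 ≤ ν u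
      · exact ⟨1, by simpa using single_mem_weightIdeal (by simpa using hνu), by lia⟩
      · exact ⟨0, by simp, by lia⟩
    | zero => exact ⟨0, by simp, by simp⟩
    | add u v _ _ hu hv =>
      obtain ⟨b, hb, hub⟩ := hu
      obtain ⟨c, hc, hvc⟩ := hv
      refine ⟨b + c, ?_, ?_⟩
      · simpa [pow_add, AddMonoidAlgebra.single_mul_single] using Ideal.mul_mem_mul hb hc
      · push_cast
        rw [map_add]
        linarith
  refine ⟨D, fun N => Ideal.span_le.2 ?_⟩
  rintro _ ⟨u, hu, rfl⟩
  obtain ⟨c, hc, huc⟩ := hpow u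
  have hNc : N ≤ c := by
    have hu' : ((D * N : ℕ) : ℤ) ≤ ν u := hu
    exact Nat.le_of_mul_le_mul_left (by exact_mod_cast hu'.trans huc) (Nat.succ_pos _)
  exact Ideal.pow_le_pow_right hNc hc

theorem IsCone.exists_single_notMem_forall_apply_eq_zero [Module.Finite ℤ M] (hσ : IsCone σ)
    (p : Ideal (CoordRing k σ)) [p.IsPrime] :
    ∃ m : dualMonoid σ, AddMonoidAlgebra.single m 1 ∉ p ∧
      ∀ v : dualMonoid σ, AddMonoidAlgebra.single v 1 ∉ p → ∀ w ∈ σ, w m = 0 → w v = 0 := by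
  classical
  obtain ⟨S, hS⟩ := hσ.fg_dualMonoid.fg_top
  have single_add (u v : dualMonoid σ) : (AddMonoidAlgebra.single (u + v) 1 : CoordRing k σ) =
      AddMonoidAlgebra.single u 1 * AddMonoidAlgebra.single v 1 := by
    rw [AddMonoidAlgebra.single_mul_single, one_mul]
  let T : Finset (dualMonoid σ) :=
    S.filter fun u => (AddMonoidAlgebra.single u 1 : CoordRing k σ) ∉ p
  refine ⟨∑ u ∈ T, u, ?_, fun v hv w hw hwm => ?_⟩
  · refine Finset.sum_induction _ (fun u => (AddMonoidAlgebra.single u 1 : CoordRing k σ) ∉ p)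
      (fun u v hu hv => ?_) ((Ideal.ne_top_iff_one p).1 ‹p.IsPrime›.ne_top)
      fun u hu => (Finset.mem_filter.1 hu).2
    rw [single_add]
    exact ‹p.IsPrime›.mul_notMem hu hv
  · have hwT : ∀ u ∈ T, w u = 0 := by
      rw [AddSubmonoid.coe_finsetSum, map_sum] at hwm
      exact (Finset.sum_eq_zero_iff_of_nonneg fun u _ => u.2 w hw).1 hwm
    induction (hS ▸ AddSubmonoid.mem_top v : v ∈ AddSubmonoid.closure S)
      using AddSubmonoid.closure_induction with
    | mem u hu => exact hwT u (Finset.mem_filter.2 ⟨hu, hv⟩)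
    | zero => exact map_zero w
    | add u v _ _ ihu ihv =>
      rw [single_add] at hv
      have hwu := ihu fun h => hv (p.mul_mem_right _ h)
      have hwv := ihv fun h => hv (p.mul_mem_left _ h)
      rw [AddSubmonoid.coe_add, map_add, hwu, hwv, add_zero]

theorem IsCone.exists_mem_weightIdeal_one_sub_mul_mem [Module.Finite ℤ M] (hτ : IsCone τ)
    (hν : latticeVector ν ∈ τ) (hint : ∀ u ∈ dualMonoid τ, ν u = 0 → -u ∈ dualMonoid τ)
    {g : κ → CoordRing k τ} (hg : ∀ l, 0 ∈ (incl k τ (g l)).coeff.support)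
    (hgI : ∀ l, incl k τ (g l) ∈ I)
    (hgen : initialIdeal (latticeVector ν) I ≤
      Ideal.span (Set.range fun l => initialForm (latticeVector ν) (incl k τ (g l))))
    {h : CoordRing k τ} (hh : incl k τ h ∈ I) :
    ∃ r ∈ weightIdeal k τ ν 1, (1 - r) * h ∈ Ideal.span (Set.range g) := by
  have := hτ.isNoetherianRing_coordRing k
  obtain ⟨D, hD⟩ := hτ.exists_weightIdeal_mul_le_pow (k := k) ν
  exact exists_one_sub_mul_mem_of_forall_mem_sup_pow fun N =>
    sup_le_sup_left (hD N) _ (mem_span_range_sup_weightIdeal hν hint hg hgI hgen hh (D * N))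

theorem IsCone.exists_single_pow_sub_mem_weightIdeal [Module.Finite ℤ M] (hσ : IsCone σ)
    {g : κ → CoordRing k σ} (hg : ∀ l, 0 ∈ (incl k σ (g l)).coeff.support)
    (hgI : ∀ l, incl k σ (g l) ∈ I)
    (hgen : ∀ w ∈ σ, initialIdeal w I ≤
      Ideal.span (Set.range fun l => initialForm w (incl k σ (g l))))
    {h : CoordRing k σ} (hh : incl k σ h ∈ I) (m : dualMonoid σ) :
    ∃ ν : M →ₗ[ℤ] ℤ, latticeVector ν ∈ σ ∧ ν m = 0 ∧ ∃ (n : ℕ) (t : CoordRing k σ),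
      AddMonoidAlgebra.single m 1 ^ n - t ∈ weightIdeal k σ ν 1 ∧
        t * h ∈ Ideal.span (Set.range g) := by
  obtain ⟨τ, hface, hτ⟩ := exists_isFace_forall_mem_iff m.2
  have hle : τ ≤ σ := fun w hw => ((hτ w).1 hw).1
  have hτcone := hσ.of_isFace hface
  obtain ⟨ν, hν, hint⟩ := hτcone.exists_latticeVector_mem
  obtain ⟨r, hr, hrh⟩ := hτcone.exists_mem_weightIdeal_one_sub_mul_mem (k := k) hν hint
    (g := fun l => restrict k hle (g l)) (h := restrict k hle h)
    (by simpa only [incl_restrict] using hg) (by simpa only [incl_restrict] using hgI)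
    (by simpa only [incl_restrict] using hgen _ (hle hν)) (by simpa only [incl_restrict] using hh)
  let := (restrict k hle).toRingHom.toAlgebra
  have := isLocalization_restrict k hσ hle m.2 hτ
  have hmap : Ideal.span (Set.range fun l => restrict k hle (g l)) =
      (Ideal.span (Set.range g)).map (algebraMap (CoordRing k σ) (CoordRing k τ)) := by
    rw [Ideal.map_span, ← Set.range_comp]
    rfl
  rw [hmap] at hrh
  obtain ⟨n, t, ht, hth⟩ := exists_algebraMap_eq_pow_mul_and_mul_mem
    (AddMonoidAlgebra.single m (1 : k)) hrh
  have ht' : restrict k hle t = restrict k hle (AddMonoidAlgebra.single m 1) ^ n * (1 - r) := ht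
  refine ⟨ν, hle hν, Int.cast_eq_zero.1 ((hτ _).1 hν).2, n, t, ?_, hth⟩
  rw [← restrict_mem_weightIdeal hle hν, map_sub, map_pow, ht', mul_sub, mul_one, sub_sub_cancel]
  exact Ideal.mul_mem_left _ _ hr

theorem IsCone.exists_notMem_mul_mem_span_range [Module.Finite ℤ M] (hσ : IsCone σ)
    {g : κ → CoordRing k σ} (hg : ∀ l, 0 ∈ (incl k σ (g l)).coeff.support)
    (hgI : ∀ l, incl k σ (g l) ∈ I)
    (hgen : ∀ w ∈ σ, initialIdeal w I ≤
      Ideal.span (Set.range fun l => initialForm w (incl k σ (g l))))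
    {h : CoordRing k σ} (hh : incl k σ h ∈ I) (p : Ideal (CoordRing k σ)) [p.IsPrime] :
    ∃ t ∉ p, t * h ∈ Ideal.span (Set.range g) := by
  obtain ⟨m, hmp, hm⟩ := hσ.exists_single_notMem_forall_apply_eq_zero p
  obtain ⟨ν, hν, hνm, n, t, hsub, hth⟩ :=
    hσ.exists_single_pow_sub_mem_weightIdeal hg hgI hgen hh m
  have hweight : weightIdeal k σ ν 1 ≤ p := by
    refine Ideal.span_le.2 ?_
    rintro _ ⟨v, hv, rfl⟩
    by_contra hvp
    have hνv : ν v = 0 := Int.cast_eq_zero.1 (hm v hvp _ hν (Int.cast_eq_zero.2 hνm))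
    have hv' : (1 : ℤ) ≤ ν v := hv
    lia
  refine ⟨t, fun htp => hmp (‹p.IsPrime›.mem_of_pow_mem n ?_), hth⟩
  rw [← sub_add_cancel (AddMonoidAlgebra.single m 1 ^ n) t]
  exact add_mem (hweight hsub) htp

theorem IsCone.span_range_eq_comap_incl [Module.Finite ℤ M] (hσ : IsCone σ)
    {g : κ → CoordRing k σ} (hg : ∀ l, 0 ∈ (incl k σ (g l)).coeff.support)
    (hI : I = Ideal.span (Set.range fun l => incl k σ (g l)))
    (hgen : ∀ w ∈ σ, initialIdeal w I ≤
      Ideal.span (Set.range fun l => initialForm w (incl k σ (g l)))) :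
    Ideal.span (Set.range g) = I.comap (incl k σ) := by
  have hgI (l) : incl k σ (g l) ∈ I := hI ▸ Ideal.subset_span ⟨l, rfl⟩
  refine le_antisymm (Ideal.span_le.2 (Set.range_subset_iff.2 hgI)) fun h hh => ?_
  exact mem_of_forall_isMaximal_exists_mul_mem fun p hp =>
    have := hp.isPrime
    hσ.exists_notMem_mul_mem_span_range hg hgI hgen hh p

/-! ### Clearing denominators -/

theorem isRadical_of_isReduced_subscheme
    (h : AlgebraicGeometry.IsReduced (subscheme I)) : I.IsRadical :=
  (Ideal.isRadical_iff_quotient_reduced I).2 ((AlgebraicGeometry.affine_isReduced_iff _).1 h)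

theorem mem_dualMonoid_of_mem_support_single_one_mul [Module.Finite ℤ M]
    {f : AddMonoidAlgebra k M} {u v : M}
    (hu : ∀ w ∈ relint σ, -u ∈ (initialForm w f).coeff.support)
    (hv : v ∈ (AddMonoidAlgebra.single u 1 * f).coeff.support) : v ∈ dualMonoid σ := by
  have hle (w) (hw : w ∈ relint σ) : w (-u) ≤ w (v - u) :=
    (mem_support_initialForm.1 (hu w hw)).2 _ (mem_support_single_one_mul.1 hv)
  simpa using sub_mem_dualMonoid_of_forall_relint_le hle

end Toric

end

theorem mainTheorem10_general {k : Type u} [Field k] {M : Type u} [AddCommGroup M]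
    [Module.Finite ℤ M] {κ : Type*} (f : κ → AddMonoidAlgebra k M)
    (I : Ideal (AddMonoidAlgebra k M)) (hI : I = Ideal.span (Set.range f))
    {σ : PointedCone ℝ (Toric.NReal M)} (hσ : Toric.IsCone σ)
    (hred : AlgebraicGeometry.IsReduced (Toric.subscheme I))
    (hconst : ∀ w₁ ∈ Toric.relint σ, ∀ w₂ ∈ Toric.relint σ,
      ∀ i, Toric.initialForm w₁ (f i) = Toric.initialForm w₂ (f i))
    (hgen : ∀ w ∈ σ, Ideal.span (Set.range fun i => Toric.initialForm w (f i)) =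
      Toric.initialIdeal w I) :
    (∀ i, ∀ v : M,
      (∀ w ∈ Toric.relint σ, v ∈ (Toric.initialForm w (f i)).coeff.support) ↔
        ∃ w ∈ Toric.relint σ, v ∈ (Toric.initialForm w (f i)).coeff.support) ∧
    ∀ u : κ → M,
      (∀ i, ∃ w ∈ Toric.relint σ, -u i ∈ (Toric.initialForm w (f i)).coeff.support) →
      ∃ g : κ → Toric.CoordRing k σ,
        (∀ i, Toric.incl k σ (g i) = AddMonoidAlgebra.single (u i) 1 * f i) ∧
        Ideal.span (Set.range g) = Toric.closureIdeal σ I := by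
  have hall (i) (v : M) : (∃ w ∈ Toric.relint σ, v ∈ (Toric.initialForm w (f i)).coeff.support) →
      ∀ w ∈ Toric.relint σ, v ∈ (Toric.initialForm w (f i)).coeff.support :=
    fun ⟨w₀, hw₀, hv⟩ w hw => hconst w₀ hw₀ w hw i ▸ hv
  refine ⟨fun i v => ⟨fun h => (Toric.relint_nonempty σ).imp fun w hw => ⟨hw, h w hw⟩, hall i v⟩,
    fun u hu => ?_⟩
  choose g hg using fun i => Toric.exists_incl_eq fun _ =>
    Toric.mem_dualMonoid_of_mem_support_single_one_mul (hall i _ (hu i))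
  have hg0 (i) : 0 ∈ (Toric.incl k σ (g i)).coeff.support := by
    obtain ⟨w, -, hmin⟩ := hu i
    rw [hg, Toric.mem_support_single_one_mul, zero_sub]
    exact (Toric.mem_support_initialForm.1 hmin).1
  refine ⟨g, hg, ?_⟩
  rw [Toric.closureIdeal_eq_comap_incl (Toric.isRadical_of_isReduced_subscheme hred)]
  refine hσ.span_range_eq_comap_incl hg0 ?_ fun w hw => ?_
  · simpa only [hg, Toric.span_range_single_one_mul] using hI
  · simpa only [hg, Toric.initialForm_single_one_mul, Toric.span_range_single_one_mul]
      using (hgen w hw).ge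

theorem mainTheorem10 {k : Type u} [Field k] [IsAlgClosed k]
    {M : Type u} [AddCommGroup M] [Module.Free ℤ M] [Module.Finite ℤ M]
    (n d : ℕ) (hn : 0 < n) (hM : Module.finrank ℤ M = n) (hd : 0 < d) (hdn : d ≤ n)
    (f : Fin (n - d) → AddMonoidAlgebra k M) (I : Ideal (AddMonoidAlgebra k M))
    (hI : I = Ideal.span (Set.range f))
    (Δ Δbar : Toric.Fan M) (σ : PointedCone ℝ (Toric.NReal M)) (hσ : σ ∈ Δbar.cones)
    (hpure : Toric.IsPureOfDim (Toric.subscheme I) d)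
    (hred : AlgebraicGeometry.IsReduced (Toric.subscheme I))
    (hsub : Δ.cones ⊆ Δbar.cones)
    (hunim : ∀ τ ∈ Δbar.cones, Toric.IsUnimodular τ)
    (htrop : Δ.IsTropical I)
    (hconst : ∀ τ, Toric.IsFace τ σ → ∀ w₁ ∈ Toric.relint τ, ∀ w₂ ∈ Toric.relint τ,
      ∀ i, Toric.initialForm w₁ (f i) = Toric.initialForm w₂ (f i))
    (hgen : ∀ w ∈ σ, Ideal.span (Set.range fun i => Toric.initialForm w (f i)) =
      Toric.initialIdeal w I) :
    (∀ i, ∀ v : M,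
      (∀ w ∈ Toric.relint σ, v ∈ (Toric.initialForm w (f i)).coeff.support) ↔
        ∃ w ∈ Toric.relint σ, v ∈ (Toric.initialForm w (f i)).coeff.support) ∧
    ∀ u : Fin (n - d) → M,
      (∀ i, ∃ w ∈ Toric.relint σ, -u i ∈ (Toric.initialForm w (f i)).coeff.support) →
      ∃ g : Fin (n - d) → Toric.CoordRing k σ,
        (∀ i, Toric.incl k σ (g i) = AddMonoidAlgebra.single (u i) 1 * f i) ∧
        Ideal.span (Set.range g) = Toric.closureIdeal σ I :=
  mainTheorem10_general f I hI (Δbar.isCone σ hσ) hred (hconst σ ⟨0, zero_mem _, by simp⟩) hgen
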